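/- **Theorem (Stationary solutions for the full Euler system).** Let $\gamma>1$, $a>0$ and $\pi(\varrho,s)=\varrho^{\gamma}e^{as}$. The stationary full Euler system on $\mathbb{R}^3$ is $$\operatorname{div}(\varrho u)=0,\qquad \operatorname{div}(\varrho u\otimes u)+\nabla \pi(\varrho,s)=0,\qquad \operatorname{div}(\varrho s u)=0,\qquad \varrho\ge 0. \tag{1}$$ (A) Let $U:\mathbb{R}^3\to\mathbb{R}^3$ and $P:\mathbb{R}^3\to\mathbb{R}$ be $C^\infty$, with $U$ compactly supported, such that $$U\cdot\nabla U+\nabla P=0,\qquad \operatorname{div}U=0,\qquad U\cdot\nabla P=0 .$$ Then $P_\infty=\lim_{|x|\to\infty}P(x)$ exists, and the following holds. (A1) Let $\varrho_\infty>0$, $s_\infty\in\mathbb{R}$, $1\le k\le\infty$, and let $\tilde\varrho,\tilde s,\Psi\in C^k(\mathbb{R})$ with $\tilde\varrho\ge0$ be such that, for some $b\le\inf P$ and constants $\varrho_0\ge0$, $s_0\in\mathbb{R}$: $\Psi=0$ outside $(b,P_\infty)$; $$\frac{d}{dz}\pi(\tilde\varrho(z),\tilde s(z))=\tilde\varrho(z)\Psi(z)^2\quad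 (z\in\mathbb{R});$$ $\tilde\varrho=\varrho_0$ and $\tilde s=s_0$ for $z\le b$; $\tilde\varrho(P_\infty)=\varrho_\infty$ and $\tilde s(P_\infty)=s_\infty$. Then $\varrho=\tilde\varrho(P)$, $s=\tilde s(P)$, $u=\Psi(P)U$ are of class $C^k$, solve (1), satisfy $u\to0$, $\varrho\to\varrho_\infty$, $s\to s_\infty$ as $|x|\to\infty$, and in fact $u=0$, $\varrho=\varrho_\infty$, $s=s_\infty$ outside some ball. Moreover $[\varrho,u]$ solves the steady non-homogeneous incompressible Euler system $$\operatorname{div}u=0,\qquad \operatorname{div}(\varrho u)=u\cdot\nabla\varrho=0,\qquad \varrho\,u\cdot\nabla u+\nabla p=0$$ with $p=\pi(\varrho,s)$. If $U\not\equiv0$ and the closed support of $\Psi$ is $[b,P_\infty]$, then $u\not\equiv0$. (A2) If $U\not\equiv 0$, then for all $\varrho_\infty>0$ and $s_\infty\in\mathbb{R}$ infinitely many distinct triplets $[\varrho,s,u]$ as in (A1) with $k=\infty$ and $\{\Psi\ne0\}=(b,P_\infty)$ have $\varrho>0$ everywhere and $u\not\equiv0$. Infinitely many of them are isentropic, $s\equiv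 s_\infty$; these also solve the non-homogeneous incompressible system. (B) In particular, for all $\varrho_\infty>0$ and $s_\infty\in\mathbb{R}$ (without reference to any $[U,P]$) there are infinitely many $C^\infty$ solutions $[\varrho,s,u]$ of (1) with $\varrho>0$ and with $u=0$, $\varrho=\varrho_\infty$, $s=s_\infty$ outside a ball. (Statement (B) does not itself assert $u\not\equiv0$; solutions with $u\not\equiv0$ are provided by (A2) for every given $U\not\equiv0$.) -/

import Mathlib

open Filter Topology Set
open scoped ContDiff

namespace SteadyEuler

/-- Physical space `ℝ³` with its Euclidean norm. -/
abbrev E3 : Type := EuclideanSpace ℝ (Fin 3)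

/-- The partial derivative `∂ᵢ f` at `x`. -/
noncomputable def pd (i : Fin 3) (f : E3 → ℝ) (x : E3) : ℝ :=
  fderiv ℝ f x (EuclideanSpace.single i (1 : ℝ))

/-- `div v = ∑ᵢ ∂ᵢ vᵢ`. -/
noncomputable def div (v : E3 → E3) (x : E3) : ℝ :=
  ∑ i, pd i (fun y => v y i) x

/-- The directional derivative `v · ∇ f = ∑ⱼ vⱼ ∂ⱼ f`. -/
noncomputable def advect (v : E3 → E3) (f : E3 → ℝ) (x : E3) : ℝ :=
  ∑ j, v x j * pd j f x

/-- A smooth solution `[U, P]` of the steady homogeneous incompressible Euler equations on `ℝ³`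
with compactly supported velocity and with `U · ∇P = 0`. -/
structure IsLocalizedIncompressible (U : E3 → E3) (P : E3 → ℝ) : Prop where
  smooth_U : ContDiff ℝ ∞ U
  smooth_P : ContDiff ℝ ∞ P
  compact_U : HasCompactSupport U
  momentum : ∀ x i, advect U (fun y => U y i) x + pd i P x = 0
  div_free : ∀ x, div U x = 0
  orthogonal : ∀ x, advect U P x = 0

/-- The polytropic equation of state `π(ρ, s) = ρ ^ γ * exp (a s)`. -/
noncomputable def pressure (γ a ρ s : ℝ) : ℝ := ρ ^ γ * Real.exp (a * s)

/-- A classical solution `[ρ, s, u]`, of class `C^k`, of the stationary full Euler system on `ℝ³`: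
`div (ρ u) = 0`, `div (ρ u ⊗ u) + ∇ π(ρ, s) = 0`, `div (ρ s u) = 0`. -/
structure IsSteadyFullEuler (γ a : ℝ) (k : ℕ∞) (ρ s : E3 → ℝ) (u : E3 → E3) : Prop where
  smooth_ρ : ContDiff ℝ k ρ
  smooth_s : ContDiff ℝ k s
  smooth_u : ContDiff ℝ k u
  nonneg_ρ : ∀ x, 0 ≤ ρ x
  pressure_diff : Differentiable ℝ (fun y => pressure γ a (ρ y) (s y))
  mass : ∀ x, div (fun y => ρ y • u y) x = 0
  momentum : ∀ x i, (∑ j, pd j (fun y => ρ y * u y i * u y j) x)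
    + pd i (fun y => pressure γ a (ρ y) (s y)) x = 0
  entropy : ∀ x, div (fun y => (ρ y * s y) • u y) x = 0

/-- The steady non-homogeneous incompressible Euler system for `[ρ, u]` with pressure `p`:
`div u = 0`, `div (ρ u) = u · ∇ρ = 0`, `ρ u · ∇u + ∇p = 0`. -/
structure IsSteadyInhomogeneous (ρ : E3 → ℝ) (u : E3 → E3) (p : E3 → ℝ) : Prop where
  diff_ρ : Differentiable ℝ ρ
  diff_u : Differentiable ℝ u
  diff_p : Differentiable ℝ p
  nonneg_ρ : ∀ x, 0 ≤ ρ x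
  div_free : ∀ x, div u x = 0
  mass : ∀ x, div (fun y => ρ y • u y) x = 0
  transport : ∀ x, advect u ρ x = 0
  momentum : ∀ x i, ρ x * advect u (fun y => u y i) x + pd i p x = 0

/-- The far field conditions `u → 0`, `ρ → ρinf`, `s → sinf` as `|x| → ∞`. -/
structure FarField (ρinf sinf : ℝ) (ρ s : E3 → ℝ) (u : E3 → E3) : Prop where
  lim_u : Tendsto u (cocompact E3) (𝓝 0)
  lim_ρ : Tendsto ρ (cocompact E3) (𝓝 ρinf)
  lim_s : Tendsto s (cocompact E3) (𝓝 sinf)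

/-- `u = 0`, `ρ = ρinf`, `s = sinf` outside a bounded ball. -/
def ConstantOutsideBall (ρinf sinf : ℝ) (ρ s : E3 → ℝ) (u : E3 → E3) : Prop :=
  ∃ R : ℝ, 0 < R ∧ ∀ x : E3, R < ‖x‖ → u x = 0 ∧ ρ x = ρinf ∧ s x = sinf

/-- Profiles `ρt, st, Ψ` of class `C^k` for the pressure `P` with limit `Pinf` at infinity:
`Ψ` is supported in `(b, Pinf)` with `b ≤ inf P`, and
`d/dz π(ρt, st) = ρt Ψ²`, `ρt = ρ0 ≥ 0` and `st = s0` for `z ≤ b`,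
`ρt Pinf = ρinf`, `st Pinf = sinf`; being a mass density, `ρt` is nonnegative. -/
structure IsProfile (γ a : ℝ) (P : E3 → ℝ) (Pinf ρinf sinf : ℝ) (k : ℕ∞)
    (b ρ0 s0 : ℝ) (ρt st Ψ : ℝ → ℝ) : Prop where
  smooth_ρt : ContDiff ℝ k ρt
  smooth_st : ContDiff ℝ k st
  smooth_Ψ : ContDiff ℝ k Ψ
  supp_Ψ : Function.support Ψ ⊆ Ioo b Pinf
  b_le : ∀ x, b ≤ P x
  nonneg_ρ0 : 0 ≤ ρ0
  nonneg_ρt : ∀ z, 0 ≤ ρt z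
  ode : ∀ z, HasDerivAt (fun y => pressure γ a (ρt y) (st y)) (ρt z * Ψ z ^ 2) z
  left_ρt : ∀ z, z ≤ b → ρt z = ρ0
  left_st : ∀ z, z ≤ b → st z = s0
  right_ρt : ρt Pinf = ρinf
  right_st : st Pinf = sinf

/-- `[ρ, s, u]` is a `C^∞` solution of the full Euler system with positive density, equal to
`[ρinf, sinf, 0]` outside a ball. -/
structure IsCompactlyPerturbed (γ a ρinf sinf : ℝ) (ρ s : E3 → ℝ) (u : E3 → E3) : Prop where
  euler : IsSteadyFullEuler γ a ⊤ ρ s u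
  pos_ρ : ∀ x, 0 < ρ x
  far : FarField ρinf sinf ρ s u
  outside : ConstantOutsideBall ρinf sinf ρ s u

/-- `[ρ, s, u] = [ρt(P), st(P), Ψ(P) U]` for some `C^∞` profiles with `Ψ` nonzero exactly
on `(b, Pinf)`. -/
def IsGenerated (γ a : ℝ) (U : E3 → E3) (P : E3 → ℝ) (Pinf ρinf sinf : ℝ)
    (ρ s : E3 → ℝ) (u : E3 → E3) : Prop :=
  ∃ (b ρ0 s0 : ℝ) (ρt st Ψ : ℝ → ℝ),
    IsProfile γ a P Pinf ρinf sinf ⊤ b ρ0 s0 ρt st Ψ ∧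
    Function.support Ψ = Ioo b Pinf ∧
    ρ = (fun x => ρt (P x)) ∧ s = (fun x => st (P x)) ∧ u = (fun x => Ψ (P x) • U x)

end SteadyEuler

/-! Since `U · ∇P = 0` and `div U = 0`, any function of `P` passes through the transport terms: `div
(g(P) U) = 0` and `div (g(P) U ⊗ U) = g(P) U · ∇U`. The profile equation gives `∇π = ρt(P) Ψ(P)²
∇P`, so the new momentum balance is `ρt(P) Ψ(P)²` times the old one (`isSteadyFullEuler`). Where `U
= 0` the momentum equation forces `∇P = 0`, so `P` is constant outside a ball, whose exterior is
connected (`exists_const_outside`).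

Nontriviality rests on the virial identity `∫ |U|² + 3 ∫ (P - Pinf) = 0`: unless `U = 0`, `P` drops
below `Pinf` somewhere (`exists_pressure_lt`), hence has a noncritical point there
(`exists_fderiv_ne_zero`), near which `Ψ(P) U` cannot vanish identically.

At constant entropy the profile equation says that `ρt ^ (γ - 1)` is affine in a primitive of `Ψ²`,
so small multiples of one bump give infinitely many positive profiles (`exists_isentropic_profile`).
Without a given flow, fluid at rest with constant pressure and compactly perturbed entropy suffices
(`isCompactlyPerturbed_rest`). -/

open MeasureTheory

namespace SteadyEuler

/-! ### Coordinate calculus on `ℝ³`. -/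

section Calculus

variable {f g : E3 → ℝ} {x : E3}

lemma pd_const (i : Fin 3) (c : ℝ) (x : E3) : pd i (fun _ => c) x = 0 := by
  simp [pd]

lemma pd_add (i : Fin 3) (hf : DifferentiableAt ℝ f x) (hg : DifferentiableAt ℝ g x) :
    pd i (fun y => f y + g y) x = pd i f x + pd i g x := by
  simp [pd, fderiv_fun_add hf hg]

lemma pd_mul (i : Fin 3) (hf : DifferentiableAt ℝ f x) (hg : DifferentiableAt ℝ g x) :
    pd i (fun y => f y * g y) x = f x * pd i g x + g x * pd i f x := by
  simp [pd, fderiv_fun_mul hf hg]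

lemma pd_comp (i : Fin 3) {h : ℝ → ℝ} {h' : ℝ} (hh : HasDerivAt h h' (f x))
    (hf : DifferentiableAt ℝ f x) : pd i (fun y => h (f y)) x = h' * pd i f x := by
  have := (hh.comp_hasFDerivAt x hf.hasFDerivAt).fderiv
  simp only [pd]
  erw [this]
  simp

lemma pd_coord (i j : Fin 3) (x : E3) : pd i (fun y => y j) x = if i = j then 1 else 0 := by
  have : HasFDerivAt (fun y : E3 => y j) (EuclideanSpace.proj j : E3 →L[ℝ] ℝ) x :=
    (EuclideanSpace.proj j : E3 →L[ℝ] ℝ).hasFDerivAt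
  simp [pd, this.fderiv, eq_comm]

lemma fderiv_eq_zero_of_pd (h : ∀ i, pd i f x = 0) : fderiv ℝ f x = 0 := by
  ext1 v
  have : ((fderiv ℝ f x : E3 →L[ℝ] ℝ) : E3 →ₗ[ℝ] ℝ) = 0 :=
    (EuclideanSpace.basisFun (Fin 3) ℝ).toBasis.ext fun i => by
      simpa [pd] using h i
  exact congrArg (fun L : E3 →ₗ[ℝ] ℝ => L v) this

lemma differentiable_coord {v : E3 → E3} (hv : Differentiable ℝ v) (i : Fin 3) :
    Differentiable ℝ (fun y => v y i) :=
  fun x => ((EuclideanSpace.proj i : E3 →L[ℝ] ℝ).differentiableAt).comp x (hv x)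

lemma div_smul {v : E3 → E3} (hf : Differentiable ℝ f) (hv : Differentiable ℝ v) (x : E3) :
    div (fun y => f y • v y) x = advect v f x + f x * div v x := by
  simp only [div, advect, Finset.mul_sum, ← Finset.sum_add_distrib]
  refine Finset.sum_congr rfl fun i _ => ?_
  have := pd_mul (x := x) i (hf x) (differentiable_coord hv i x)
  simp only [PiLp.smul_apply, smul_eq_mul]
  rw [this]; ring

lemma advect_comp (v : E3 → E3) {h : ℝ → ℝ} (hh : Differentiable ℝ h)
    (hf : Differentiable ℝ f) (x : E3) :
    advect v (fun y => h (f y)) x = deriv h (f x) * advect v f x := by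
  simp only [advect, Finset.mul_sum]
  refine Finset.sum_congr rfl fun i _ => ?_
  rw [pd_comp i (hh (f x)).hasDerivAt (hf x)]; ring

lemma advect_mul (v : E3 → E3) (hf : DifferentiableAt ℝ f x) (hg : DifferentiableAt ℝ g x) :
    advect v (fun y => f y * g y) x = f x * advect v g x + g x * advect v f x := by
  simp only [advect, Finset.mul_sum, ← Finset.sum_add_distrib]
  refine Finset.sum_congr rfl fun i _ => ?_
  rw [pd_mul i hf hg]; ring

end Calculus

/-! ### Behaviour at infinity. -/

/-- The complement of a closed ball centred at the origin of `ℝ³` is connected. -/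
lemma isPreconnected_norm_gt {R : ℝ} (hR : 0 ≤ R) : IsPreconnected {x : E3 | R < ‖x‖} := by
  have hrank : 1 < Module.rank ℝ E3 := by
    apply Module.one_lt_rank_of_one_lt_finrank
    simp
  have hS := (isConnected_sphere hrank (0 : E3) zero_le_one).isPreconnected
  -- Polar coordinates: the exterior is the image of sphere × `(R, ∞)` under `(v, t) ↦ t • v`.
  have := (hS.prod (isPreconnected_Ioi (a := R))).image (fun p : E3 × ℝ => p.2 • p.1)
    (by fun_prop)
  convert this using 1
  ext x
  simp only [mem_ofPred_eq, mem_image, mem_prod, mem_sphere_iff_norm, sub_zero, mem_Ioi,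
    Prod.exists]
  constructor
  · intro hx
    have h0 : 0 < ‖x‖ := hR.trans_lt hx
    refine ⟨‖x‖⁻¹ • x, ‖x‖, ⟨?_, hx⟩, ?_⟩
    · rw [norm_smul, norm_inv, norm_norm, inv_mul_cancel₀ h0.ne']
    · rw [smul_smul, mul_inv_cancel₀ h0.ne', one_smul]
  · rintro ⟨v, t, ⟨hv, ht⟩, rfl⟩
    rw [norm_smul, hv, mul_one]
    exact ht.trans_le (le_abs_self t)

namespace IsLocalizedIncompressible

variable {U : E3 → E3} {P : E3 → ℝ}

lemma differentiable_U (h : IsLocalizedIncompressible U P) : Differentiable ℝ U :=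
  h.smooth_U.differentiable (by simp)

lemma differentiable_P (h : IsLocalizedIncompressible U P) : Differentiable ℝ P :=
  h.smooth_P.differentiable (by simp)

lemma fderiv_pressure_eq_zero (h : IsLocalizedIncompressible U P) {x : E3} (hx : U x = 0) :
    fderiv ℝ P x = 0 := by
  refine fderiv_eq_zero_of_pd fun i => ?_
  have := h.momentum x i
  simpa [advect, hx] using this

/-- Outside a ball the velocity vanishes and the pressure is constant. -/
lemma exists_const_outside (h : IsLocalizedIncompressible U P) :
    ∃ Pinf R : ℝ, 0 < R ∧ ∀ x : E3, R < ‖x‖ → U x = 0 ∧ P x = Pinf := by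
  obtain ⟨R, hR, hsub⟩ := h.compact_U.isCompact.isBounded.subset_closedBall_lt 0 0
  have hU : ∀ x : E3, R < ‖x‖ → U x = 0 := fun x hx => by
    by_contra hne
    have := hsub (subset_tsupport _ (Function.mem_support.2 hne))
    simp at this
    linarith
  obtain ⟨Pinf, hP⟩ := (isOpen_lt continuous_const continuous_norm :
    IsOpen {x : E3 | R < ‖x‖}).exists_is_const_of_fderiv_eq_zero
      (isPreconnected_norm_gt hR.le) h.differentiable_P.differentiableOn
      (fun x hx => h.fderiv_pressure_eq_zero (hU x hx))
  exact ⟨Pinf, R, hR, fun x hx => ⟨hU x hx, hP x hx⟩⟩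

end IsLocalizedIncompressible

lemma eventually_cocompact_lt_norm (R : ℝ) : ∀ᶠ x : E3 in cocompact E3, R < ‖x‖ :=
  (tendsto_norm_cocompact_atTop (E := E3)).eventually_gt_atTop R

lemma ConstantOutsideBall.farField {ρinf sinf : ℝ} {ρ s : E3 → ℝ} {u : E3 → E3}
    (h : ConstantOutsideBall ρinf sinf ρ s u) : FarField ρinf sinf ρ s u := by
  obtain ⟨R, -, hR⟩ := h
  have he := eventually_cocompact_lt_norm R
  exact ⟨tendsto_const_nhds.congr' (he.mono fun x hx => (hR x hx).1.symm),
    tendsto_const_nhds.congr' (he.mono fun x hx => (hR x hx).2.1.symm),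
    tendsto_const_nhds.congr' (he.mono fun x hx => (hR x hx).2.2.symm)⟩

/-! ### The virial identity and nontriviality of the velocity. -/

/-- The divergence theorem for compactly supported functions, in coordinate form. -/
lemma integral_pd_eq_zero {f : E3 → ℝ} (hf : ContDiff ℝ 1 f) (hc : HasCompactSupport f)
    (i : Fin 3) : ∫ x, pd i f x = 0 := by
  have hd : Continuous (fun x => pd i f x) :=
    (hf.continuous_fderiv (by simp)).clm_apply continuous_const
  have hdc : HasCompactSupport (fun x => pd i f x) := hc.fderiv_apply (𝕜 := ℝ) _
  have hi : Integrable (fun x => pd i f x) (volume : Measure E3) :=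
    hd.integrable_of_hasCompactSupport hdc
  have hif : Integrable f (volume : Measure E3) :=
    hf.continuous.integrable_of_hasCompactSupport hc
  -- Integration by parts against the constant `1`.
  have := integral_mul_fderiv_eq_neg_fderiv_mul_of_integrable (μ := (volume : Measure E3))
    (𝕜 := ℝ) (f := fun _ => (1 : ℝ)) (g := f) (v := EuclideanSpace.single i (1 : ℝ))
    (by simp) (by simpa only [one_mul] using! hi)
    (by simpa only [one_mul] using! hif)
    (by intros; fun_prop) (fun x _ => (hf.differentiable (by simp)) x)
  simpa [pd] using this

namespace IsLocalizedIncompressible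

variable {U : E3 → E3} {P : E3 → ℝ}

/-- The virial field `(x · U) U + (P - c) x`. -/
noncomputable def virial (U : E3 → E3) (P : E3 → ℝ) (c : ℝ) (j : Fin 3) (x : E3) : ℝ :=
  (∑ i, x i * U x i) * U x j + x j * (P x + -c)

/-- Differentiating the factor `x` produces `|U|²` and `3 (P - c)`; what remains is `(x · U) div U`
plus `x` dotted with the momentum equation. -/
lemma sum_pd_virial (h : IsLocalizedIncompressible U P) (c : ℝ) (x : E3) :
    ∑ j, pd j (virial U P c j) x = ∑ i, U x i ^ 2 + 3 * (P x + -c) := by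
  have dU := fun i => differentiable_coord h.differentiable_U i x
  have dx : ∀ i : Fin 3, DifferentiableAt ℝ (fun y : E3 => y i) x := fun i =>
    (EuclideanSpace.proj i : E3 →L[ℝ] ℝ).differentiableAt
  have dP := h.differentiable_P x
  have e : ∀ j, pd j (virial U P c j) x =
      ((∑ i, x i * U x i) * pd j (fun y => U y j) x
        + U x j * ∑ i, (x i * pd j (fun y => U y i) x + U x i * if j = i then 1 else 0))
      + (x j * pd j P x + (P x + -c)) := by
    intro j
    have d1 : ∀ i, DifferentiableAt ℝ (fun y : E3 => y i * U y i) x := fun i =>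
      (dx i).mul (dU i)
    have ds : pd j (fun y : E3 => ∑ i, y i * U y i) x =
        ∑ i, (x i * pd j (fun y => U y i) x + U x i * if j = i then 1 else 0) := by
      simp only [Fin.sum_univ_three]
      have d01 : DifferentiableAt ℝ (fun y : E3 => y 0 * U y 0 + y 1 * U y 1) x :=
        (d1 0).add (d1 1)
      rw [pd_add j d01 (d1 2), pd_add j (d1 0) (d1 1)]
      simp only [pd_mul j (dx _) (dU _), pd_coord]
    have dsum : DifferentiableAt ℝ (fun y : E3 => ∑ i, y i * U y i) x := by
      simp only [Fin.sum_univ_three]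
      exact ((d1 0).add (d1 1)).add (d1 2)
    have dPc : DifferentiableAt ℝ (fun y => P y + -c) x := dP.add_const _
    have dl : DifferentiableAt ℝ (fun y : E3 => (∑ i, y i * U y i) * U y j) x :=
      dsum.mul (dU j)
    have dr : DifferentiableAt ℝ (fun y : E3 => y j * (P y + -c)) x := (dx j).mul dPc
    unfold virial
    rw [pd_add j dl dr, pd_mul j dsum (dU j),
      pd_mul j (dx j) dPc, ds, pd_add j dP (differentiableAt_const _), pd_const, pd_coord]
    simp
  simp only [e]
  have h0 := h.momentum x 0
  have h1 := h.momentum x 1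
  have h2 := h.momentum x 2
  have hd := h.div_free x
  simp only [advect, div, Fin.sum_univ_three] at h0 h1 h2 hd ⊢
  simp
  linear_combination (x 0 * U x 0 + x 1 * U x 1 + x 2 * U x 2) * hd
    + x 0 * h0 + x 1 * h1 + x 2 * h2

/-- By the virial identity `∫ |U|² + 3 ∫ (P - P∞) = 0`, the pressure of a nontrivial flow
takes values below its limit at infinity. -/
lemma exists_pressure_lt (h : IsLocalizedIncompressible U P) {Pinf R : ℝ}
    (hR : ∀ x : E3, R < ‖x‖ → U x = 0 ∧ P x = Pinf) (hU : U ≠ 0) : ∃ x, P x < Pinf := by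
  by_contra! hge
  have cU : ∀ i : Fin 3, ContDiff ℝ 1 (fun y : E3 => U y i) := fun i =>
    (EuclideanSpace.proj i : E3 →L[ℝ] ℝ).contDiff.comp (h.smooth_U.of_le (by simp))
  have cx : ∀ i : Fin 3, ContDiff ℝ 1 (fun y : E3 => y i) := fun i =>
    (EuclideanSpace.proj i : E3 →L[ℝ] ℝ).contDiff
  have cP : ContDiff ℝ 1 (fun y : E3 => P y + -Pinf) :=
    (h.smooth_P.of_le (by simp)).add contDiff_const
  have cV : ∀ j, ContDiff ℝ 1 (virial U P Pinf j) := fun j =>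
    ((ContDiff.sum fun i _ => (cx i).mul (cU i)).mul (cU j)).add ((cx j).mul cP)
  have sV : ∀ j, HasCompactSupport (virial U P Pinf j) := fun j =>
    HasCompactSupport.intro (isCompact_closedBall (0 : E3) R) fun x hx => by
      have := hR x (by simpa using hx)
      simp [virial, this.1, this.2]
  have key : ∫ x, ∑ j, pd j (virial U P Pinf j) x = 0 := by
    rw [integral_finsetSum]
    · exact Finset.sum_eq_zero fun j _ => integral_pd_eq_zero (cV j) (sV j) j
    · intro j _
      exact (((cV j).continuous_fderiv (by simp)).clm_apply
        continuous_const).integrable_of_hasCompactSupport ((sV j).fderiv_apply (𝕜 := ℝ) _)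
  simp only [h.sum_pd_virial] at key
  set F : E3 → ℝ := fun x => ∑ i, U x i ^ 2 + 3 * (P x + -Pinf) with hF
  have F0 : 0 ≤ F := fun x => by
    have h1 : 0 ≤ ∑ i, U x i ^ 2 := Finset.sum_nonneg fun i _ => sq_nonneg _
    have := hge x
    simp only [hF, Pi.zero_apply]; linarith
  have Fc : Continuous F :=
    (continuous_finsetSum _ fun i _ => (cU i).continuous.pow 2).add
      (continuous_const.mul cP.continuous)
  have Fs : HasCompactSupport F :=
    HasCompactSupport.intro (isCompact_closedBall (0 : E3) R) fun x hx => by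
      have := hR x (by simpa using hx)
      simp [hF, this.1, this.2]
  -- A nonnegative continuous function with zero integral vanishes everywhere, not just almost
  -- everywhere.
  have Fz : F = 0 := by
    have := (integral_eq_zero_iff_of_nonneg F0 (Fc.integrable_of_hasCompactSupport Fs)).1 key
    exact (Fc.ae_eq_iff_eq volume continuous_const).1 this
  refine hU (funext fun x => ?_)
  have hx : F x = 0 := congrFun Fz x
  have h1 : ∑ i, U x i ^ 2 = 0 := by
    have h2 : 0 ≤ ∑ i, U x i ^ 2 := Finset.sum_nonneg fun i _ => sq_nonneg _
    have := hge x
    simp only [hF] at hx; linarith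
  ext i
  have := (Finset.sum_eq_zero_iff_of_nonneg fun i _ => sq_nonneg _).1 h1 i (Finset.mem_univ i)
  simpa using this

/-- The pressure of a nontrivial flow is not critical at some point where it is below its
limit at infinity. -/
lemma exists_fderiv_ne_zero (h : IsLocalizedIncompressible U P) {Pinf R : ℝ}
    (hR : ∀ x : E3, R < ‖x‖ → U x = 0 ∧ P x = Pinf) (hU : U ≠ 0) :
    ∃ x, P x < Pinf ∧ fderiv ℝ P x ≠ 0 := by
  by_contra! hcon
  obtain ⟨x₀, hx₀⟩ := h.exists_pressure_lt hR hU
  have hc := h.smooth_P.continuous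
  have ho : IsOpen {x : E3 | P x < Pinf} := isOpen_lt hc continuous_const
  -- If `P` were critical throughout `{P < Pinf}`, the level set through `x₀` would be open as well
  -- as closed, hence all of space, contradicting `P = Pinf` far out.
  have h1 := ho.isOpen_inter_preimage_of_fderiv_eq_zero h.differentiable_P.differentiableOn
    (fun x hx => hcon x hx) {P x₀}
  have h2 : {x : E3 | P x < Pinf} ∩ P ⁻¹' {P x₀} = P ⁻¹' {P x₀} :=
    inter_eq_right.2 fun x hx => by
      have : P x = P x₀ := hx
      simpa [this] using hx₀
  rw [h2] at h1
  have h3 : P ⁻¹' {P x₀} = univ :=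
    IsClopen.eq_univ ⟨isClosed_singleton.preimage hc, h1⟩ ⟨x₀, rfl⟩
  obtain ⟨y, hy⟩ := (eventually_cocompact_lt_norm R).exists
  have h4 : P y = P x₀ := by
    have : y ∈ P ⁻¹' {P x₀} := h3 ▸ mem_univ y
    exact this
  rw [(hR y hy).2] at h4
  exact hx₀.ne h4.symm

/-- At a noncritical point `P` is open, so values where `Ψ ≠ 0`, dense in `[b, Pinf]`, are taken
arbitrarily close to it; `U` is nonzero nearby because zeros of `U` are critical points of `P`. -/
lemma exists_smul_ne_zero (h : IsLocalizedIncompressible U P) {Pinf R : ℝ}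
    (hR : ∀ x : E3, R < ‖x‖ → U x = 0 ∧ P x = Pinf) (hU : U ≠ 0) {b : ℝ} (hb : ∀ x, b ≤ P x)
    {Ψ : ℝ → ℝ} (hΨ : tsupport Ψ = Icc b Pinf) : ∃ x, Ψ (P x) • U x ≠ 0 := by
  obtain ⟨x, hx, hd⟩ := h.exists_fderiv_ne_zero hR hU
  have hs : HasStrictFDerivAt P (fderiv ℝ P x) x :=
    h.smooth_P.contDiffAt.hasStrictFDerivAt (by simp)
  have hsurj : (fderiv ℝ P x).range = ⊤ := by
    refine LinearMap.range_eq_top.2 (LinearMap.surjective ?_)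
    intro h0
    exact hd (ContinuousLinearMap.coe_injective h0)
  have hmap := hs.map_nhds_eq_of_surj hsurj
  have hmem : P x ∈ closure (Function.support Ψ) := by
    change P x ∈ tsupport Ψ
    rw [hΨ]; exact ⟨hb x, hx.le⟩
  have hfreq : ∃ᶠ y in 𝓝 x, Ψ (P y) ≠ 0 := by
    rw [mem_closure_iff_frequently, ← hmap, frequently_map] at hmem
    exact hmem
  have hUx : U x ≠ 0 := fun h0 => hd (h.fderiv_pressure_eq_zero h0)
  obtain ⟨y, hy1, hy2⟩ :=
    (hfreq.and_eventually (h.smooth_U.continuous.continuousAt.eventually_ne hUx)).exists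
  exact ⟨y, smul_ne_zero hy1 hy2⟩

/-! ### From profiles to solutions. -/

lemma div_comp_smul (h : IsLocalizedIncompressible U P) {g : ℝ → ℝ} (hg : Differentiable ℝ g)
    (x : E3) : div (fun y => g (P y) • U y) x = 0 := by
  rw [div_smul (f := fun y => g (P y)) (hg.comp h.differentiable_P) h.differentiable_U,
    advect_comp U hg h.differentiable_P, h.orthogonal, h.div_free]
  simp

/-- This is `div (f U) = U · ∇f` with `f = g(P) Uᵢ`; the derivative of `g(P)` along `U` drops out by
orthogonality. -/
lemma sum_pd_comp_mul_mul (h : IsLocalizedIncompressible U P) {g : ℝ → ℝ}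
    (hg : Differentiable ℝ g) (x : E3) (i : Fin 3) :
    ∑ j, pd j (fun y => g (P y) * U y i * U y j) x
      = g (P x) * advect U (fun y => U y i) x := by
  have hgP : Differentiable ℝ (fun y => g (P y)) := hg.comp h.differentiable_P
  have hUi := differentiable_coord h.differentiable_U i
  have hf : Differentiable ℝ (fun y => g (P y) * U y i) := hgP.mul hUi
  have e := div_smul hf h.differentiable_U x
  rw [advect_mul U (hgP x) (hUi x), advect_comp U hg h.differentiable_P, h.orthogonal,
    h.div_free] at e
  simpa [div] using e

lemma advect_comp_smul (h : IsLocalizedIncompressible U P) {g : ℝ → ℝ}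
    (hg : Differentiable ℝ g) (x : E3) (i : Fin 3) :
    advect (fun y => g (P y) • U y) (fun y => (g (P y) • U y) i) x
      = g (P x) ^ 2 * advect U (fun y => U y i) x := by
  have hgP : Differentiable ℝ (fun y => g (P y)) := hg.comp h.differentiable_P
  have hUi := differentiable_coord h.differentiable_U i
  have e : ∀ f, advect (fun y => g (P y) • U y) f x = g (P x) * advect U f x := fun f => by
    simp only [advect, Finset.mul_sum, PiLp.smul_apply, smul_eq_mul, mul_assoc]
  rw [e]
  simp only [PiLp.smul_apply, smul_eq_mul]
  rw [advect_mul U (hgP x) (hUi x), advect_comp U hg h.differentiable_P, h.orthogonal]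
  ring

section Profile

variable {γ a Pinf ρinf sinf b ρ0 s0 : ℝ} {k : ℕ∞} {ρt st Ψ : ℝ → ℝ}

/-- Differentiability of the pressure is taken from the profile equation rather than from the power
law, so vacuum is allowed. -/
lemma isSteadyFullEuler (h : IsLocalizedIncompressible U P) (hk : 1 ≤ k)
    (hp : IsProfile γ a P Pinf ρinf sinf k b ρ0 s0 ρt st Ψ) :
    IsSteadyFullEuler γ a k
      (fun x => ρt (P x)) (fun x => st (P x)) (fun x => Ψ (P x) • U x) := by
  have hk' : (k : WithTop ℕ∞) ≠ 0 := by
    have : k ≠ 0 := (zero_lt_one.trans_le hk).ne'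
    exact_mod_cast this
  have hkle : (k : WithTop ℕ∞) ≤ ∞ := by exact_mod_cast le_top
  have dρ := hp.smooth_ρt.differentiable hk'
  have ds := hp.smooth_st.differentiable hk'
  have dΨ := hp.smooth_Ψ.differentiable hk'
  have cP : ContDiff ℝ k P := h.smooth_P.of_le hkle
  refine ⟨hp.smooth_ρt.comp cP, hp.smooth_st.comp cP,
    (hp.smooth_Ψ.comp cP).smul (h.smooth_U.of_le hkle), fun x => hp.nonneg_ρt _,
    fun x => ((hp.ode (P x)).differentiableAt).comp x (h.differentiable_P x), ?_, ?_, ?_⟩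
  · intro x
    simp only [smul_smul]
    exact h.div_comp_smul (dρ.mul dΨ) x
  · intro x i
    rw [pd_comp i (hp.ode (P x)) (h.differentiable_P x)]
    have e : ∀ j, (fun y => ρt (P y) * (Ψ (P y) • U y) i * (Ψ (P y) • U y) j)
        = fun y => (fun z => ρt z * Ψ z ^ 2) (P y) * U y i * U y j := fun j => by
      funext y; simp only [PiLp.smul_apply, smul_eq_mul]; ring
    simp only [e]
    rw [h.sum_pd_comp_mul_mul (g := fun z => ρt z * Ψ z ^ 2) (dρ.mul (dΨ.pow 2)),
      ← mul_add, h.momentum, mul_zero]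
  · intro x
    simp only [smul_smul]
    exact h.div_comp_smul ((dρ.mul ds).mul dΨ) x

lemma isSteadyInhomogeneous (h : IsLocalizedIncompressible U P) (hk : 1 ≤ k)
    (hp : IsProfile γ a P Pinf ρinf sinf k b ρ0 s0 ρt st Ψ) :
    IsSteadyInhomogeneous (fun x => ρt (P x)) (fun x => Ψ (P x) • U x)
      (fun x => pressure γ a (ρt (P x)) (st (P x))) := by
  have hk' : (k : WithTop ℕ∞) ≠ 0 := by
    have : k ≠ 0 := (zero_lt_one.trans_le hk).ne'
    exact_mod_cast this
  have hE := h.isSteadyFullEuler hk hp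
  have dρ := hp.smooth_ρt.differentiable hk'
  have dΨ := hp.smooth_Ψ.differentiable hk'
  refine ⟨hE.smooth_ρ.differentiable hk', hE.smooth_u.differentiable hk', hE.pressure_diff,
    hE.nonneg_ρ, h.div_comp_smul dΨ, hE.mass, ?_, ?_⟩
  · intro x
    rw [advect_comp _ dρ h.differentiable_P]
    have : advect (fun y => Ψ (P y) • U y) P x = Ψ (P x) * advect U P x := by
      simp only [advect, Finset.mul_sum, PiLp.smul_apply, smul_eq_mul, mul_assoc]
    rw [this, h.orthogonal]; simp
  · intro x i
    rw [h.advect_comp_smul dΨ, pd_comp i (hp.ode (P x)) (h.differentiable_P x)]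
    linear_combination (ρt (P x) * Ψ (P x) ^ 2) * h.momentum x i

end Profile

end IsLocalizedIncompressible

lemma IsProfile.constantOutsideBall {γ a Pinf ρinf sinf b ρ0 s0 R : ℝ} {k : ℕ∞}
    {ρt st Ψ : ℝ → ℝ} {U : E3 → E3} {P : E3 → ℝ}
    (hp : IsProfile γ a P Pinf ρinf sinf k b ρ0 s0 ρt st Ψ) (hR0 : 0 < R)
    (hR : ∀ x : E3, R < ‖x‖ → U x = 0 ∧ P x = Pinf) :
    ConstantOutsideBall ρinf sinf
      (fun x => ρt (P x)) (fun x => st (P x)) (fun x => Ψ (P x) • U x) :=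
  ⟨R, hR0, fun x hx => by simp [hR x hx, hp.right_ρt, hp.right_st]⟩

/-! ### Explicit isentropic profiles. -/

/-- A smooth function on the line that is positive exactly on `(b, c)`. -/
noncomputable def plateau (b c z : ℝ) : ℝ := expNegInvGlue (z - b) * expNegInvGlue (c - z)

lemma contDiff_plateau (b c : ℝ) : ContDiff ℝ ∞ (plateau b c) :=
  (expNegInvGlue.contDiff.comp (contDiff_id.sub contDiff_const)).mul
    (expNegInvGlue.contDiff.comp (contDiff_const.sub contDiff_id))

lemma support_plateau (b c : ℝ) : Function.support (plateau b c) = Ioo b c := by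
  ext z
  simp [plateau]

/-- The primitive of `plateau b c ^ 2` that vanishes on `(-∞, b]`. -/
noncomputable def plateauEnergy (b c z : ℝ) : ℝ := ∫ t in b..z, plateau b c t ^ 2

lemma hasDerivAt_plateauEnergy (b c z : ℝ) :
    HasDerivAt (plateauEnergy b c) (plateau b c z ^ 2) z :=
  ((contDiff_plateau b c).continuous.pow 2).integral_hasStrictDerivAt b z |>.hasDerivAt

lemma contDiff_plateauEnergy (b c : ℝ) : ContDiff ℝ ∞ (plateauEnergy b c) := by
  rw [contDiff_infty_iff_deriv]
  refine ⟨fun z => (hasDerivAt_plateauEnergy b c z).differentiableAt, ?_⟩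
  have : deriv (plateauEnergy b c) = fun z => plateau b c z ^ 2 :=
    funext fun z => (hasDerivAt_plateauEnergy b c z).deriv
  rw [this]
  exact (contDiff_plateau b c).pow 2

lemma plateauEnergy_of_le {b z : ℝ} (c : ℝ) (hz : z ≤ b) : plateauEnergy b c z = 0 := by
  refine intervalIntegral.integral_zero_ae (Eventually.of_forall fun t ht => ?_)
  rw [uIoc_of_ge hz] at ht
  have : t ∉ Function.support (plateau b c) := by
    rw [support_plateau]; exact fun h => absurd h.1 (not_lt.2 ht.2)
  simp [Function.notMem_support.1 this]

lemma plateauEnergy_nonneg (b c z : ℝ) : 0 ≤ plateauEnergy b c z := by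
  rcases le_total z b with hz | hz
  · rw [plateauEnergy_of_le c hz]
  · exact intervalIntegral.integral_nonneg hz fun t _ => sq_nonneg _

/-- Isentropic profiles with `Ψ` a small multiple of `plateau b Pinf`: `ρt ^ (γ - 1)` is an affine
function of the primitive of `Ψ ^ 2`. -/
lemma exists_isentropic_profile {γ : ℝ} (a : ℝ) (hγ : 1 < γ) {P : E3 → ℝ} {b Pinf ρinf : ℝ}
    (sinf : ℝ) (hb : ∀ x, b ≤ P x) (hρ : 0 < ρinf) :
    ∃ δ > 0, ∀ ε ∈ Ioo 0 δ, ∃ (ρ0 : ℝ) (ρt : ℝ → ℝ), (∀ z, 0 < ρt z) ∧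
      IsProfile γ a P Pinf ρinf sinf ⊤ b ρ0 sinf ρt (fun _ => sinf)
        (fun z => ε * plateau b Pinf z) := by
  have hγ1 : 0 < γ - 1 := by linarith
  have hγ0 : 0 < γ := by linarith
  -- At constant `s` the profile equation reads `(ρt ^ (γ - 1))' = C Ψ²`.
  set C : ℝ := (γ - 1) / γ * Real.exp (-(a * sinf)) with hC
  have hC0 : 0 < C := by positivity
  set M : ℝ := plateauEnergy b Pinf Pinf with hM
  have hK : 0 < ρinf ^ (γ - 1) := Real.rpow_pos_of_pos hρ _
  -- Smallness of `ε` keeps `w`, the candidate for `ρt ^ (γ - 1)`, positive: its lowest possible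
  -- value is `ρinf ^ (γ - 1) - C ε² M`.
  have hev : ∀ᶠ ε : ℝ in 𝓝[>] 0, C * ε ^ 2 * M < ρinf ^ (γ - 1) := by
    have hcont : Continuous (fun ε : ℝ => C * ε ^ 2 * M) := by fun_prop
    have := hcont.tendsto 0
    simp only [ne_eq, OfNat.ofNat_ne_zero, not_false_eq_true, zero_pow, mul_zero,
      zero_mul] at this
    exact (this.mono_left nhdsWithin_le_nhds).eventually_lt_const hK
  obtain ⟨δ, hδ, hsub⟩ := mem_nhdsGT_iff_exists_Ioo_subset.1 hev
  refine ⟨δ, hδ, fun ε hε => ?_⟩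
  have hεM : C * ε ^ 2 * M < ρinf ^ (γ - 1) := hsub hε
  -- Subtracting `M` normalises `w Pinf = ρinf ^ (γ - 1)`.
  set w : ℝ → ℝ := fun z => ρinf ^ (γ - 1) + C * ε ^ 2 * (plateauEnergy b Pinf z - M) with hw
  have w0 : ∀ z, 0 < w z := fun z => by
    have : 0 ≤ C * ε ^ 2 * plateauEnergy b Pinf z :=
      mul_nonneg (by positivity) (plateauEnergy_nonneg _ _ _)
    simp only [hw]; linarith
  have wd : ∀ z, HasDerivAt w (C * ε ^ 2 * plateau b Pinf z ^ 2) z := fun z =>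
    (((hasDerivAt_plateauEnergy b Pinf z).sub_const M).const_mul (C * ε ^ 2)).const_add _
  have wc : ContDiff ℝ ∞ w := by
    have := contDiff_plateauEnergy b Pinf
    fun_prop
  have hpow : ∀ z, (w z ^ (1 / (γ - 1))) ^ γ = w z ^ (γ / (γ - 1)) := fun z => by
    rw [← Real.rpow_mul (w0 z).le]; congr 1; field_simp
  have hcst : ∀ z ≤ b, w z = w b := fun z hz => by
    simp only [hw, plateauEnergy_of_le Pinf hz, plateauEnergy_of_le Pinf le_rfl]
  have ρpos : ∀ z, 0 < w z ^ (1 / (γ - 1)) := fun z => Real.rpow_pos_of_pos (w0 z) _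
  refine ⟨w b ^ (1 / (γ - 1)), fun z => w z ^ (1 / (γ - 1)), ρpos, ?_⟩
  refine ⟨wc.rpow_const_of_ne fun z => (w0 z).ne', contDiff_const,
    contDiff_const.mul (contDiff_plateau b Pinf), ?_, hb, (ρpos b).le, fun z => (ρpos z).le,
    fun z => ?_, fun z hz => by simp only [hcst z hz], fun _ _ => rfl, ?_, rfl⟩
  · rw [← support_plateau]
    intro z hz
    exact right_ne_zero_of_mul hz
  · simp only [pressure, hpow]
    have h1 := ((wd z).rpow_const (p := γ / (γ - 1)) (Or.inl (w0 z).ne')).mul_const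
      (Real.exp (a * sinf))
    refine h1.congr_deriv (Eq.symm ?_)
    have e1 : γ / (γ - 1) - 1 = 1 / (γ - 1) := by field_simp; ring
    have e2 : Real.exp (-(a * sinf)) * Real.exp (a * sinf) = 1 := by
      rw [← Real.exp_add]; simp
    rw [e1, hC]
    calc w z ^ (1 / (γ - 1)) * (ε * plateau b Pinf z) ^ 2
        = w z ^ (1 / (γ - 1)) * (ε * plateau b Pinf z) ^ 2 *
          (Real.exp (-(a * sinf)) * Real.exp (a * sinf)) := by rw [e2, mul_one]
      _ = _ := by field_simp
  · simp only [hw, ← hM, sub_self, mul_zero, add_zero]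
    rw [← Real.rpow_mul hρ.le, mul_one_div_cancel hγ1.ne', Real.rpow_one]

/-! ### Infinite families of solutions. -/

/-- Compactly supported perturbations of a constant state at rest and at constant pressure. -/
lemma isCompactlyPerturbed_rest {γ : ℝ} (a : ℝ) (hγ : 0 < γ) {ρinf : ℝ} (sinf : ℝ)
    (hρ : 0 < ρinf) {φ : E3 → ℝ} (hφ : ContDiff ℝ ∞ φ) (hc : HasCompactSupport φ) :
    IsCompactlyPerturbed γ a ρinf sinf (fun x => ρinf * Real.exp (-(a * φ x / γ)))
      (fun x => sinf + φ x) (fun _ => 0) := by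
  -- The factor `exp (-(a φ / γ))`, raised to the power `γ`, cancels `exp (a φ)`.
  have hp : ∀ x, pressure γ a (ρinf * Real.exp (-(a * φ x / γ))) (sinf + φ x)
      = pressure γ a ρinf sinf := fun x => by
    simp only [pressure]
    rw [Real.mul_rpow hρ.le (Real.exp_pos _).le, ← Real.exp_mul, mul_assoc, ← Real.exp_add]
    congr 2
    field_simp
    ring
  have hout : ConstantOutsideBall ρinf sinf (fun x => ρinf * Real.exp (-(a * φ x / γ)))
      (fun x => sinf + φ x) (fun _ => 0) := by
    obtain ⟨R, hR, hsub⟩ := hc.isCompact.isBounded.subset_closedBall_lt 0 0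
    refine ⟨R, hR, fun x hx => ?_⟩
    have : φ x = 0 := by
      by_contra hne
      have := hsub (subset_tsupport _ (Function.mem_support.2 hne))
      simp at this
      linarith
    simp [this]
  have hpos : ∀ x, 0 < ρinf * Real.exp (-(a * φ x / γ)) := fun x =>
    mul_pos hρ (Real.exp_pos _)
  refine ⟨⟨?_, contDiff_const.add hφ, contDiff_const, fun x => (hpos x).le, ?_, ?_, ?_, ?_⟩,
    hpos, hout.farField, hout⟩
  · exact contDiff_const.mul (((contDiff_const.mul hφ).div_const γ).neg.exp)
  · simp only [hp]; exact differentiable_const _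
  · intro x; simp [div, pd_const]
  · intro x i; simp [hp, pd_const]
  · intro x; simp [div, pd_const]

/-- The perturbations `t β` of the entropy, with `β` a fixed bump, are told apart by the entropy at
the origin. -/
lemma infinite_isCompactlyPerturbed {γ : ℝ} (a : ℝ) (hγ : 0 < γ) {ρinf : ℝ} (sinf : ℝ)
    (hρ : 0 < ρinf) :
    {q : (E3 → ℝ) × (E3 → ℝ) × (E3 → E3) |
      IsCompactlyPerturbed γ a ρinf sinf q.1 q.2.1 q.2.2}.Infinite := by
  let β : ContDiffBump (0 : E3) := ⟨1, 2, one_pos, one_lt_two⟩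
  refine infinite_of_injective_forall_mem
    (f := fun t : ℝ => ((fun x => ρinf * Real.exp (-(a * (t * β x) / γ))),
      (fun x => sinf + t * β x), fun _ => 0)) ?_ fun t =>
    isCompactlyPerturbed_rest a hγ sinf hρ (contDiff_const.mul β.contDiff)
      (β.hasCompactSupport.mul_left)
  intro t t' htt
  have h1 : sinf + t * β 0 = sinf + t' * β 0 :=
    congrFun (congrArg (fun q : (E3 → ℝ) × (E3 → ℝ) × (E3 → E3) => q.2.1) htt) 0
  have h2 : β 0 = 1 := β.one_of_mem_closedBall (by simp [β])
  simpa [h2] using h1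

/-- The parameter is the amplitude `ε` of the bump; evaluating the velocity at one point where
`plateau b Pinf (P x) • U x` is nonzero recovers `ε` and shows nontriviality. -/
lemma IsLocalizedIncompressible.infinite_isentropic {U : E3 → E3} {P : E3 → ℝ}
    (h : IsLocalizedIncompressible U P) {γ : ℝ} (a : ℝ) (hγ : 1 < γ) {Pinf R : ℝ} (hR0 : 0 < R)
    (hR : ∀ x : E3, R < ‖x‖ → U x = 0 ∧ P x = Pinf) (hlim : Tendsto P (cocompact E3) (𝓝 Pinf))
    (hU : U ≠ 0) {ρinf : ℝ} (sinf : ℝ) (hρ : 0 < ρinf) :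
    {q : (E3 → ℝ) × (E3 → E3) |
      IsGenerated γ a U P Pinf ρinf sinf q.1 (fun _ => sinf) q.2 ∧
      IsCompactlyPerturbed γ a ρinf sinf q.1 (fun _ => sinf) q.2 ∧
      IsSteadyInhomogeneous q.1 q.2 (fun x => pressure γ a (q.1 x) sinf) ∧
      q.2 ≠ 0}.Infinite := by
  -- `b` is the minimum of `P`, attained because `P` goes below its limit at infinity; `b < Pinf`
  -- makes the closed support of the bump `[b, Pinf]`.
  obtain ⟨b, hb, hbP⟩ : ∃ b, (∀ x, b ≤ P x) ∧ b < Pinf := by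
    obtain ⟨x₁, hx₁⟩ := h.exists_pressure_lt hR hU
    obtain ⟨y, hy⟩ := h.smooth_P.continuous.exists_forall_le' x₁
      ((hlim.eventually_const_lt hx₁).mono fun _ => le_of_lt)
    exact ⟨P y, hy, (hy x₁).trans_lt hx₁⟩
  obtain ⟨δ, hδ, hprof⟩ := exists_isentropic_profile (Pinf := Pinf) a hγ sinf hb hρ
  choose! ρ0 ρt hpos hp using hprof
  have hsupp : ∀ ε ∈ Ioo 0 δ,
      Function.support (fun z => ε * plateau b Pinf z) = Ioo b Pinf := fun ε hε => by
    rw [← support_plateau]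
    ext z
    simp [hε.1.ne']
  have hts : tsupport (plateau b Pinf) = Icc b Pinf := by
    rw [tsupport, support_plateau, closure_Ioo hbP.ne]
  obtain ⟨x, hx⟩ := h.exists_smul_ne_zero hR hU hb hts
  have hinj : InjOn (fun ε : ℝ => ((fun y => ρt ε (P y)),
      (fun y => (ε * plateau b Pinf (P y)) • U y))) (Ioo 0 δ) := by
    intro ε _ ε' _ he
    have h1 : (ε * plateau b Pinf (P x)) • U x = (ε' * plateau b Pinf (P x)) • U x :=
      congrFun (congrArg (fun q : (E3 → ℝ) × (E3 → E3) => q.2) he) x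
    rw [mul_smul, mul_smul] at h1
    exact smul_left_injective ℝ hx h1
  refine ((Ioo_infinite hδ).image hinj).mono ?_
  rintro _ ⟨ε, hε, rfl⟩
  have hball := (hp ε hε).constantOutsideBall hR0 hR
  refine ⟨⟨b, ρ0 ε, sinf, ρt ε, fun _ => sinf, _, hp ε hε, hsupp ε hε, rfl, rfl, rfl⟩,
    ⟨h.isSteadyFullEuler le_top (hp ε hε), fun y => hpos ε hε _, hball.farField, hball⟩,
    h.isSteadyInhomogeneous le_top (hp ε hε), fun h0 => ?_⟩
  have h1 : (ε * plateau b Pinf (P x)) • U x = 0 := congrFun h0 x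
  rw [mul_smul] at h1
  exact hx ((smul_eq_zero.1 h1).resolve_left hε.1.ne')

end SteadyEuler

theorem theorem2p1 (γ a : ℝ) (hγ : 1 < γ) (ha : 0 < a) :
    (∀ (U : SteadyEuler.E3 → SteadyEuler.E3) (P : SteadyEuler.E3 → ℝ),
      SteadyEuler.IsLocalizedIncompressible U P →
      ∃ Pinf : ℝ, Tendsto P (cocompact SteadyEuler.E3) (𝓝 Pinf) ∧
        -- every triplet built from admissible profiles is a solution
        (∀ (ρinf sinf : ℝ), 0 < ρinf → ∀ (k : ℕ∞), 1 ≤ k →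
          ∀ (b ρ0 s0 : ℝ) (ρt st Ψ : ℝ → ℝ),
          SteadyEuler.IsProfile γ a P Pinf ρinf sinf k b ρ0 s0 ρt st Ψ →
          SteadyEuler.IsSteadyFullEuler γ a k
            (fun x => ρt (P x)) (fun x => st (P x)) (fun x => Ψ (P x) • U x) ∧
          SteadyEuler.FarField ρinf sinf
            (fun x => ρt (P x)) (fun x => st (P x)) (fun x => Ψ (P x) • U x) ∧
          SteadyEuler.ConstantOutsideBall ρinf sinf
            (fun x => ρt (P x)) (fun x => st (P x)) (fun x => Ψ (P x) • U x) ∧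
          SteadyEuler.IsSteadyInhomogeneous
            (fun x => ρt (P x)) (fun x => Ψ (P x) • U x)
            (fun x => SteadyEuler.pressure γ a (ρt (P x)) (st (P x))) ∧
          (U ≠ 0 → tsupport Ψ = Icc b Pinf → ∃ x, Ψ (P x) • U x ≠ 0)) ∧
        -- a nontrivial `U` generates infinitely many solutions with nontrivial velocity,
        -- and infinitely many isentropic ones
        (U ≠ 0 → ∀ (ρinf sinf : ℝ), 0 < ρinf →
          {q : (SteadyEuler.E3 → ℝ) × (SteadyEuler.E3 → ℝ) × (SteadyEuler.E3 → SteadyEuler.E3) |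
            SteadyEuler.IsGenerated γ a U P Pinf ρinf sinf q.1 q.2.1 q.2.2 ∧
            SteadyEuler.IsCompactlyPerturbed γ a ρinf sinf q.1 q.2.1 q.2.2 ∧
            q.2.2 ≠ 0}.Infinite ∧
          {q : (SteadyEuler.E3 → ℝ) × (SteadyEuler.E3 → SteadyEuler.E3) |
            SteadyEuler.IsGenerated γ a U P Pinf ρinf sinf q.1 (fun _ => sinf) q.2 ∧
            SteadyEuler.IsCompactlyPerturbed γ a ρinf sinf q.1 (fun _ => sinf) q.2 ∧
            SteadyEuler.IsSteadyInhomogeneous q.1 q.2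
              (fun x => SteadyEuler.pressure γ a (q.1 x) sinf) ∧
            q.2 ≠ 0}.Infinite)) ∧
    -- for arbitrary far field data there are infinitely many smooth solutions
    (∀ (ρinf sinf : ℝ), 0 < ρinf →
      {q : (SteadyEuler.E3 → ℝ) × (SteadyEuler.E3 → ℝ) × (SteadyEuler.E3 → SteadyEuler.E3) |
        SteadyEuler.IsCompactlyPerturbed γ a ρinf sinf q.1 q.2.1 q.2.2}.Infinite) := by
  refine ⟨fun U P h => ?_, fun ρinf sinf hρ =>
    SteadyEuler.infinite_isCompactlyPerturbed a (by linarith) sinf hρ⟩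
  obtain ⟨Pinf, R, hR0, hR⟩ := h.exists_const_outside
  have hlim : Tendsto P (cocompact SteadyEuler.E3) (𝓝 Pinf) :=
    tendsto_const_nhds.congr'
      ((SteadyEuler.eventually_cocompact_lt_norm R).mono fun x hx => (hR x hx).2.symm)
  refine ⟨Pinf, hlim, ?_, ?_⟩
  · intro ρinf sinf _ k hk b ρ0 s0 ρt st Ψ hp
    have hball := hp.constantOutsideBall hR0 hR
    exact ⟨h.isSteadyFullEuler hk hp, hball.farField, hball, h.isSteadyInhomogeneous hk hp,
      fun hU hΨ => h.exists_smul_ne_zero hR hU hp.b_le hΨ⟩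
  · intro hU ρinf sinf hρ
    have hinf := h.infinite_isentropic a hγ hR0 hR hlim hU sinf hρ
    refine ⟨?_, hinf⟩
    -- The isentropic family already supplies infinitely many triplets.
    refine (hinf.image (f := fun q => (q.1, (fun _ => sinf), q.2)) ?_).mono ?_
    · rintro ⟨ρ, u⟩ _ ⟨ρ', u'⟩ _ he
      simpa using he
    · rintro _ ⟨q, ⟨hg, hc, -, hne⟩, rfl⟩
      exact ⟨hg, hc, hne⟩
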